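/- Let $p$ be a prime and let $R$ be a regular ring of characteristic $p$ (commutative, Noetherian, with every localization at a prime ideal a regular local ring) that is $F$-finite, i.e. the Frobenius map $F : R \to R$, $r \mapsto r^p$, is finite. Let $e \geq 1$ and $q = p^e$. Let $R[F^e]$ be the ring obtained from $R$ by adjoining a non-commutative variable $F^e$ with the relations $F^e r = r^{q} F^e$ for $r \in R$. Write $R^{n}$ for $R$ viewed as an $R$-$R$-bimodule, with the usual left structure and the right structure $a \cdot r = r^{p^{n}} a$. An $R[F^e]$-module $\mathcal{M}$ is called unit if the $R$-linear map $\theta^e : R^e \otimes_R \mathcal{M} \to \mathcal{M}$, $a \otimes m \mapsto a F^e(m)$, is an isomorphism, and finitely generated if it is finitely generated as a module over the ring $R[F^e]$. Let $D_R = \bigcup_{n \geq 0} \operatorname{End}_{R^{p^n}}(R)$ be the ring of differential operators on $R$, where $R^{p^n} \subseteq R$ denotes the subring of $p^n$-th powers. It acts on every unit $R[F^e]$-module $\mathcal{M}$: an operator $\delta \in \operatorname{End}_{R^{p^{er}}}(R)$ acts as $\theta^{er} \circ (\delta \otimes \mathrm{id}_{\mathcal{M}}) \circ (\theta^{er})^{-1}$,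 where $\theta^{er} : R^{er} \otimes_R \mathcal{M} \to \mathcal{M}$, $a \otimes m \mapsto a (F^{e})^r(m)$, is again an isomorphism; this does not depend on the choice of $r$. Let $\mathcal{M}$ be a finitely generated unit $R[F^e]$-module and let $\mathcal{N} \subseteq \mathcal{M}$ be a $D_R[F^e]$-submodule, that is, a $D_R$-submodule with $F^e(\mathcal{N}) \subseteq \mathcal{N}$. Then $\mathcal{N}$, as an $R[F^e]$-module, is unit and finitely generated. -/

import Mathlib

open scoped TensorProduct

noncomputable section

namespace FrobD

universe u v

section DiffOp

/-- The differential operators of level `n`, `End_{R^{p^n}}(R)`: the additive endomorphisms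
of `R` that are linear over the subring of `p^n`-th powers. -/
def diffOpLevel (R : Type u) [CommRing R] (p n : ℕ) : Subring (AddMonoid.End R) where
  carrier := {δ | ∀ r x : R, δ (r ^ p ^ n * x) = r ^ p ^ n * δ x}
  mul_mem' {a b} ha hb r x := by
    change a (b _) = _ * a (b _)
    rw [hb, ha]
  one_mem' _ _ := rfl
  add_mem' {a b} ha hb r x := by
    change a _ + b _ = _ * (a _ + b _)
    rw [ha, hb, mul_add]
  zero_mem' r x := (mul_zero (r ^ p ^ n)).symm
  neg_mem' {a} ha r x := by
    change -a _ = _ * -a _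
    rw [ha, mul_neg]

theorem diffOpLevel_mono (R : Type u) [CommRing R] (p : ℕ) {m n : ℕ} (h : m ≤ n) : diffOpLevel R p m ≤ diffOpLevel R p n := by
  intro δ hδ r x
  obtain ⟨k, rfl⟩ := Nat.exists_eq_add_of_le h
  have := hδ (r ^ p ^ k) x
  rwa [← pow_mul, ← pow_add, add_comm k m] at this

/-- The ring `D_R` of differential operators on `R`, `⋃ₙ End_{R^{p^n}}(R)`. -/
def diffOp (R : Type u) [CommRing R] (p : ℕ) : Subring (AddMonoid.End R) where
  carrier := {δ | ∃ n, δ ∈ diffOpLevel R p n}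
  mul_mem' := by
    rintro a b ⟨m, ha⟩ ⟨n, hb⟩
    exact ⟨max m n, mul_mem (diffOpLevel_mono R p (le_max_left m n) ha)
      (diffOpLevel_mono R p (le_max_right m n) hb)⟩
  one_mem' := ⟨0, one_mem _⟩
  add_mem' := by
    rintro a b ⟨m, ha⟩ ⟨n, hb⟩
    exact ⟨max m n, add_mem (diffOpLevel_mono R p (le_max_left m n) ha)
      (diffOpLevel_mono R p (le_max_right m n) hb)⟩
  zero_mem' := ⟨0, zero_mem _⟩
  neg_mem' := by
    rintro a ⟨m, ha⟩
    exact ⟨m, neg_mem ha⟩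

theorem exists_level {R : Type u} [CommRing R] {p e : ℕ} (he : 0 < e) (δ : diffOp R p) :
    ∃ r, δ.1 ∈ diffOpLevel R p (e * r) := by
  obtain ⟨n, hn⟩ := δ.2
  exact ⟨n, diffOpLevel_mono R p (Nat.le_mul_of_pos_left n he) hn⟩

end DiffOp

section Ring

variable (R : Type u) [CommRing R] (p : ℕ) [Fact p.Prime] [CharP R p] (e : ℕ)

/-- The action of the free monoid on one letter on `R` in which the letter acts by the `e`-th
iterate of the Frobenius endomorphism, `r ↦ r ^ p ^ e`. -/
@[reducible] def frobMulSemiringAction : MulSemiringAction (Multiplicative ℕ) R :=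
  MulSemiringAction.compHom R (powersHom (R →+* R) (iterateFrobenius R p e))

/-- The ring `R[F^e]`: the skew polynomial ring over `R` in one variable `F^e`, subject to the
relations `F^e r = r ^ p ^ e F^e`. -/
def FrobRing (R : Type u) [CommRing R] (p : ℕ) [Fact p.Prime] [CharP R p] (_e : ℕ) : Type u :=
  SkewPolynomial R

instance instRingFrobRing : Ring (FrobRing R p e) :=
  letI := frobMulSemiringAction R p e
  inferInstanceAs (Ring (SkewPolynomial R))

/-- `R` acts on `R[F^e]` by multiplication from the left. -/
instance instModuleFrobRing : Module R (FrobRing R p e) := inferInstanceAs (Module R (SkewPolynomial R))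

/-- The variable `F^e` of `R[F^e]`. -/
def frobVar : FrobRing R p e := (SkewPolynomial.monomial 1 (1 : R) : SkewPolynomial R)

theorem frobVar_mul_smul_one (r : R) :
    frobVar R p e * (r • (1 : FrobRing R p e)) = r ^ p ^ e • frobVar R p e := by
  let := frobMulSemiringAction R p e
  change (SkewPolynomial.monomial 1 (1 : R) : SkewPolynomial R) *
    (r • SkewPolynomial.monomial 0 (1 : R)) =
      r ^ p ^ e • (SkewPolynomial.monomial 1 (1 : R) : SkewPolynomial R)
  rw [SkewPolynomial.smul_monomial, SkewPolynomial.monomial_mul_monomial,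
    SkewPolynomial.smul_monomial]
  simp only [smul_eq_mul, mul_one, one_mul, add_zero, Function.iterate_one]
  rfl

/-- The Frobenius action `F^e : M → M` of an `R[F^e]`-module `M`: the `p^e`-linear map given by
the action of the variable. -/
def frobAction (M : Type v) [AddCommGroup M] [Module R M] [Module (FrobRing R p e) M]
    [IsScalarTower R (FrobRing R p e) M] : M →ₛₗ[iterateFrobenius R p e] M where
  toFun m := frobVar R p e • m
  map_add' x y := smul_add _ x y
  map_smul' r x := by
    change frobVar R p e • (r • x) = r ^ p ^ e • (frobVar R p e • x)
    rw [← smul_assoc (r ^ p ^ e), ← frobVar_mul_smul_one, mul_smul, smul_assoc, one_smul]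

/-- `R^n`: the ring `R` viewed as an `R`-`R`-bimodule, on the left by multiplication, and on the
right via the `n`-th iterate of Frobenius. -/
def FrobTwist (R : Type u) (_p _n : ℕ) : Type u := R

instance instCommRingFrobTwist (n : ℕ) : CommRing (FrobTwist R p n) := inferInstanceAs (CommRing R)

/-- The twisted (right) `R`-module structure on `R^n`: `a · r = r ^ p ^ n * a`, written `r • a`. The left structure
is multiplication in `R`. -/
instance instModuleFrobTwist (n : ℕ) : Module R (FrobTwist R p n) :=
  letI : Module R R := Module.compHom R (iterateFrobenius R p n)
  inferInstanceAs (Module R R)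

/-- The identity map from `R` to `R^n`. -/
def twist {R : Type u} [CommRing R] (p n : ℕ) : R ≃+* FrobTwist R p n := RingEquiv.refl R

theorem smul_twist (n : ℕ) (r a : R) : r • twist p n a = twist p n (r ^ p ^ n * a) := rfl

/-- A differential operator of level `n`, as an endomorphism of the right `R`-module `R^n`. -/
def diffOpLevel.toEnd {n : ℕ} (δ : diffOpLevel R p n) : Module.End R (FrobTwist R p n) where
  toFun a := twist p n (δ.1 ((twist p n).symm a))
  map_add' := δ.1.map_add
  map_smul' r a := δ.2 r a

end Ring

section Structure

variable {R : Type u} [CommRing R] {p : ℕ} [Fact p.Prime] [CharP R p]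
variable {M : Type v} [AddCommGroup M] [Module R M]

/-- The Frobenius structure `θ : R^n ⊗ M → M`, `a ⊗ m ↦ a F(m)`, attached to a `p^n`-linear map
`F : M → M`. (It is linear for the left `R`-module structure of `R^n`.) -/
def structureMap {n : ℕ} (F : M →ₛₗ[iterateFrobenius R p n] M) :
    FrobTwist R p n ⊗[R] M →+ M :=
  TensorProduct.liftAddHom
    (AddMonoidHom.mk' (fun a : FrobTwist R p n =>
        AddMonoidHom.mk' (fun m : M => (twist p _).symm a • F m)
          (fun x y => by rw [map_add, smul_add]))
      (fun a b => by ext m; exact add_smul ((twist p _).symm a) ((twist p _).symm b) (F m)))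
    (fun r a m => by
      change (r ^ p ^ n * ((twist p _).symm a)) • F m = (twist p _).symm a • F (r • m)
      rw [LinearMap.map_smulₛₗ, iterateFrobenius_def, smul_smul, mul_comm])

theorem structureMap_tmul {n : ℕ} (F : M →ₛₗ[iterateFrobenius R p n] M) (a : R) (m : M) :
    structureMap F (twist p n a ⊗ₜ[R] m) = a • F m := rfl

/-- The Frobenius structure is *unit* if `θ : R^n ⊗ M → M` is an isomorphism. -/
def IsUnitFrob {n : ℕ} (F : M →ₛₗ[iterateFrobenius R p n] M) : Prop :=
  Function.Bijective (structureMap F)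

variable {e : ℕ} (F : M →ₛₗ[iterateFrobenius R p e] M)

/-- The `r`-th iterate `F^{er}` of a `p^e`-linear map `F^e`, a `p^{er}`-linear map. -/
def frobIter (r : ℕ) : M →ₛₗ[iterateFrobenius R p (e * r)] M where
  toFun := F^[r]
  map_add' := iterate_map_add F r
  map_smul' c x := by
    induction r with
    | zero => simp
    | succ r ih =>
      rw [Function.iterate_succ_apply', ih, Function.iterate_succ_apply', LinearMap.map_smulₛₗ]
      simp only [iterateFrobenius_def, ← pow_mul, ← pow_add, Nat.mul_succ]

theorem frobIter_zero (m : M) : frobIter F 0 m = m := rfl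

theorem frobIter_succ (r : ℕ) (m : M) : frobIter F (r + 1) m = F (frobIter F r m) :=
  Function.iterate_succ_apply' F r m

theorem frobIter_add (r s : ℕ) (m : M) :
    frobIter F (r + s) m = frobIter F r (frobIter F s m) :=
  Function.iterate_add_apply F r s m

/-- Multiplication from the left on `R^n ⊗ M`. -/
def leftMul (n : ℕ) (c : R) : FrobTwist R p n ⊗[R] M →+ FrobTwist R p n ⊗[R] M :=
  (LinearMap.rTensor M
    ({ toFun := fun a => twist p n c * a
       map_add' := mul_add _
       map_smul' := fun r a => mul_left_comm c (r ^ p ^ n) a } :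
      FrobTwist R p n →ₗ[R] FrobTwist R p n)).toAddMonoidHom

theorem leftMul_tmul (n : ℕ) (c a : R) (m : M) :
    leftMul n c (twist p n a ⊗ₜ[R] m) =
      twist p n (c * a) ⊗ₜ[R] m := rfl

theorem leftMul_add_left (n : ℕ) (a b : R) (t : FrobTwist R p n ⊗[R] M) :
    leftMul n (a + b) t = leftMul n a t + leftMul n b t := by
  induction t using TensorProduct.induction_on with
  | zero => simp
  | tmul c m =>
    exact (congrArg (fun z : FrobTwist R p n => z ⊗ₜ[R] m)
      (add_mul (twist p n a) (twist p n b) c)).trans (TensorProduct.add_tmul _ _ m)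
  | add x y hx hy => rw [map_add, map_add, map_add, hx, hy]; abel

theorem structureMap_leftMul {n : ℕ} (G : M →ₛₗ[iterateFrobenius R p n] M) (c : R)
    (t : FrobTwist R p n ⊗[R] M) : structureMap G (leftMul n c t) = c • structureMap G t := by
  induction t using TensorProduct.induction_on with
  | zero => simp
  | tmul a m => exact mul_smul c ((twist p _).symm a) (G m)
  | add x y hx hy => rw [map_add, map_add, map_add, hx, hy, smul_add]

/-- `b ⊗ m ↦ b ^ p ^ e ⊗ m`. -/
def frobTensor (M : Type v) [AddCommGroup M] [Module R M] (e r : ℕ) :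
    FrobTwist R p (e * r) ⊗[R] M →+ FrobTwist R p (e * (r + 1)) ⊗[R] M :=
  TensorProduct.liftAddHom
    (AddMonoidHom.mk' (fun b : FrobTwist R p (e * r) =>
        AddMonoidHom.mk' (fun m : M =>
          twist p (e * (r + 1)) (iterateFrobenius R p e ((twist p (e * r)).symm b)) ⊗ₜ[R] m)
          (fun x y => TensorProduct.tmul_add _ x y))
      (fun a b => by
        ext m
        exact (congrArg (fun z : FrobTwist R p (e * (r + 1)) => z ⊗ₜ[R] m)
          (map_add (iterateFrobenius R p e) a b)).trans (TensorProduct.add_tmul _ _ m)))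
    (fun c b m => by
      change twist p (e * (r + 1))
          (iterateFrobenius R p e (c ^ p ^ (e * r) * (twist p (e * r)).symm b)) ⊗ₜ[R] m =
        twist p (e * (r + 1)) (iterateFrobenius R p e ((twist p (e * r)).symm b)) ⊗ₜ[R] (c • m)
      rw [← TensorProduct.smul_tmul, smul_twist, map_mul]
      simp only [iterateFrobenius_def, ← pow_mul, ← pow_add, Nat.mul_succ])

theorem frobTensor_tmul (r : ℕ) (b : R) (m : M) :
    frobTensor M e r (twist p (e * r) b ⊗ₜ[R] m) =
      twist p (e * (r + 1)) (b ^ p ^ e) ⊗ₜ[R] m := rfl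

theorem frobTensor_leftMul (r : ℕ) (c : R) (t : FrobTwist R p (e * r) ⊗[R] M) :
    frobTensor M e r (leftMul _ c t) = leftMul _ (c ^ p ^ e) (frobTensor M e r t) := by
  induction t using TensorProduct.induction_on with
  | zero => simp
  | tmul b m =>
    exact congrArg (fun z : FrobTwist R p (e * (r + 1)) => z ⊗ₜ[R] m)
      (mul_pow c ((twist p _).symm b) (p ^ e))
  | add x y hx hy => rw [map_add, map_add, map_add, map_add, hx, hy]

theorem structureMap_frobTensor (r : ℕ) (t : FrobTwist R p (e * r) ⊗[R] M) :
    structureMap (frobIter F (r + 1)) (frobTensor M e r t) =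
      F (structureMap (frobIter F r) t) := by
  induction t using TensorProduct.induction_on with
  | zero => simp
  | tmul b m =>
    change (((twist p _).symm b) ^ p ^ e) • frobIter F (r + 1) m =
      F (((twist p _).symm b) • frobIter F r m)
    rw [LinearMap.map_smulₛₗ, frobIter_succ, iterateFrobenius_def]
  | add x y hx hy => rw [map_add, map_add, map_add, map_add, hx, hy]

/-- If `θ^e` is an isomorphism, then so is every `θ^{er} : R^{er} ⊗ M → M`. -/
theorem IsUnitFrob.iter {F : M →ₛₗ[iterateFrobenius R p e] M} (h : IsUnitFrob F) (r : ℕ) :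
    IsUnitFrob (frobIter F r) := by
  induction r with
  | zero =>
    have key : ∀ t : FrobTwist R p (e * 0) ⊗[R] M,
        t = twist p (e * 0) (1 : R) ⊗ₜ[R] structureMap (frobIter F 0) t := by
      intro t
      induction t using TensorProduct.induction_on with
      | zero => rw [map_zero, TensorProduct.tmul_zero]
      | tmul a m =>
        change a ⊗ₜ[R] m = twist p (e * 0) (1 : R) ⊗ₜ[R] (((twist p _).symm a) • m)
        rw [← TensorProduct.smul_tmul, smul_twist, mul_zero, pow_zero, pow_one, mul_one]
        rfl
      | add x y hx hy => rw [map_add, TensorProduct.tmul_add, ← hx, ← hy]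
    refine ⟨fun s t hst => ?_, fun m => ⟨twist p (e * 0) (1 : R) ⊗ₜ[R] m, ?_⟩⟩
    · rw [key s, key t, hst]
    · rw [structureMap_tmul, one_smul, frobIter_zero]
  | succ r ih =>
    let E := AddEquiv.ofBijective _ ih
    let E₁ := AddEquiv.ofBijective _ h
    have hE : ∀ t, E t = structureMap (frobIter F r) t := fun _ => rfl
    have hsymm : ∀ (c : R) (m : M), E.symm (c • m) = leftMul _ c (E.symm m) := by
      intro c m
      rw [AddEquiv.symm_apply_eq, hE, structureMap_leftMul, ← hE, AddEquiv.apply_symm_apply]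
    have hone : ∀ m : M, E.symm (frobIter F r m) =
        twist p (e * r) (1 : R) ⊗ₜ[R] m := by
      intro m
      rw [AddEquiv.symm_apply_eq, hE, structureMap_tmul, one_smul]
    let Φ : FrobTwist R p e ⊗[R] M →+ FrobTwist R p (e * (r + 1)) ⊗[R] M :=
      TensorProduct.liftAddHom
        (AddMonoidHom.mk' (fun a : FrobTwist R p e =>
            (leftMul _ ((twist p _).symm a)).comp ((frobTensor M e r).comp E.symm.toAddMonoidHom))
          (fun a b => by
            ext m
            change leftMul _ (((twist p _).symm a) + ((twist p _).symm b)) (frobTensor M e r (E.symm m)) =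
              leftMul _ ((twist p _).symm a) (frobTensor M e r (E.symm m)) +
              leftMul _ ((twist p _).symm b) (frobTensor M e r (E.symm m))
            exact leftMul_add_left _ _ _ _))
        (fun c a m => by
          change leftMul _ (c ^ p ^ e * ((twist p _).symm a)) (frobTensor M e r (E.symm m)) =
            leftMul _ ((twist p _).symm a) (frobTensor M e r (E.symm (c • m)))
          rw [hsymm, frobTensor_leftMul]
          generalize frobTensor M e r (E.symm m) = t
          induction t using TensorProduct.induction_on with
          | zero => simp
          | tmul b m =>
            refine congrArg (fun z : FrobTwist R p (e * (r + 1)) => z ⊗ₜ[R] m) ?_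
            change c ^ p ^ e * ((twist p _).symm a) * ((twist p _).symm b) =
              ((twist p _).symm a) * (c ^ p ^ e * ((twist p _).symm b))
            ring
          | add x y hx hy => rw [map_add, map_add, map_add, hx, hy])
    have hΦ : ∀ s, structureMap (frobIter F (r + 1)) (Φ s) = structureMap F s := by
      intro s
      induction s using TensorProduct.induction_on with
      | zero => simp
      | tmul a m =>
        change structureMap (frobIter F (r + 1))
          (leftMul _ ((twist p _).symm a) (frobTensor M e r (E.symm m))) = (twist p _).symm a • F m
        rw [structureMap_leftMul, structureMap_frobTensor, ← hE, AddEquiv.apply_symm_apply]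
      | add x y hx hy => rw [map_add, map_add, map_add, hx, hy]
    have hinv : ∀ t, Φ (E₁.symm (structureMap (frobIter F (r + 1)) t)) = t := by
      intro t
      induction t using TensorProduct.induction_on with
      | zero => simp
      | tmul a m =>
        have : E₁.symm (structureMap (frobIter F (r + 1)) (a ⊗ₜ[R] m)) =
            twist p e ((twist p _).symm a) ⊗ₜ[R] frobIter F r m := by
          rw [AddEquiv.symm_apply_eq]
          change (twist p _).symm a • frobIter F (r + 1) m = (twist p _).symm a • F (frobIter F r m)
          rw [frobIter_succ]
        rw [this]
        change leftMul _ ((twist p _).symm a) (frobTensor M e r (E.symm (frobIter F r m))) = a ⊗ₜ[R] m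
        rw [hone]
        refine congrArg (fun z : FrobTwist R p (e * (r + 1)) => z ⊗ₜ[R] m) ?_
        change ((twist p _).symm a) * (1 : R) ^ p ^ e = a
        rw [one_pow, mul_one]
        rfl
      | add x y hx hy => rw [map_add, map_add, map_add, hx, hy]
    refine ⟨fun s t hst => ?_, fun m => ⟨Φ (E₁.symm m), ?_⟩⟩
    · rw [← hinv s, ← hinv t, hst]
    · rw [hΦ]
      exact E₁.apply_symm_apply m

/-- The isomorphism `θ^{er} : R^{er} ⊗ M ≃ M` of a unit module. -/
def structureEquiv {F : M →ₛₗ[iterateFrobenius R p e] M} (h : IsUnitFrob F) (r : ℕ) :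
    FrobTwist R p (e * r) ⊗[R] M ≃+ M :=
  AddEquiv.ofBijective (structureMap (frobIter F r)) (h.iter r)

variable {F} (h : IsUnitFrob F)

/-- A differential operator `δ` of level `er` acts on a unit module `M` as the composite
`M → R^{er} ⊗ M → R^{er} ⊗ M → M` of `(θ^{er})⁻¹`, `δ ⊗ id` and `θ^{er}`. -/
def levelAction (r : ℕ) (δ : diffOpLevel R p (e * r)) : AddMonoid.End M :=
  (structureEquiv h r).toAddMonoidHom.comp
    ((LinearMap.rTensor M (diffOpLevel.toEnd R p δ)).toAddMonoidHom.comp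
      (structureEquiv h r).symm.toAddMonoidHom)

theorem levelAction_smul_frobIter (r : ℕ) (δ : diffOpLevel R p (e * r)) (a : R) (m : M) :
    levelAction h r δ (a • frobIter F r m) = δ.1 a • frobIter F r m := by
  have : (structureEquiv h r).symm (a • frobIter F r m) =
      twist p (e * r) a ⊗ₜ[R] m := by
    rw [AddEquiv.symm_apply_eq]; rfl
  change structureEquiv h r (LinearMap.rTensor M (diffOpLevel.toEnd R p δ)
    ((structureEquiv h r).symm (a • frobIter F r m))) = _
  rw [this]
  rfl

theorem addHom_ext_of_isUnitFrob (r : ℕ) {f g : AddMonoid.End M} (h : IsUnitFrob F)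
    (hfg : ∀ (a : R) (m : M), f (a • frobIter F r m) = g (a • frobIter F r m)) : f = g := by
  ext m
  obtain ⟨t, rfl⟩ := (h.iter r).2 m
  induction t using TensorProduct.induction_on with
  | zero => simp
  | tmul a m => exact hfg a m
  | add x y hx hy => rw [map_add, map_add, map_add, hx, hy]

/-- The action of a differential operator does not depend on the level. -/
theorem levelAction_add_level (r s : ℕ) (δ : AddMonoid.End R)
    (hr : δ ∈ diffOpLevel R p (e * r)) (hs : δ ∈ diffOpLevel R p (e * (r + s))) :
    levelAction h r ⟨δ, hr⟩ = levelAction h (r + s) ⟨δ, hs⟩ := by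
  refine addHom_ext_of_isUnitFrob r h fun a m => ?_
  rw [levelAction_smul_frobIter]
  obtain ⟨t, rfl⟩ := (h.iter s).2 m
  induction t using TensorProduct.induction_on with
  | zero => simp
  | tmul b m =>
    have key : ∀ c : R, c • frobIter F r (((twist p _).symm b) • frobIter F s m) =
        (((twist p _).symm b) ^ p ^ (e * r) * c) • frobIter F (r + s) m := by
      intro c
      rw [LinearMap.map_smulₛₗ, iterateFrobenius_def, smul_smul, frobIter_add, mul_comm]
    change δ a • frobIter F r (((twist p _).symm b) • frobIter F s m) =
      levelAction h (r + s) ⟨δ, hs⟩ (a • frobIter F r (((twist p _).symm b) • frobIter F s m))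
    rw [key, key, levelAction_smul_frobIter]
    exact congrArg (· • frobIter F (r + s) m) (hr ((twist p _).symm b) a).symm
  | add x y hx hy => simp only [map_add, smul_add, hx, hy]

theorem levelAction_eq {r s : ℕ} (δ : AddMonoid.End R)
    (hr : δ ∈ diffOpLevel R p (e * r)) (hs : δ ∈ diffOpLevel R p (e * s)) :
    levelAction h r ⟨δ, hr⟩ = levelAction h s ⟨δ, hs⟩ := by
  rcases le_total r s with hrs | hrs
  · obtain ⟨k, rfl⟩ := Nat.exists_eq_add_of_le hrs
    exact levelAction_add_level h r k δ hr hs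
  · obtain ⟨k, rfl⟩ := Nat.exists_eq_add_of_le hrs
    exact (levelAction_add_level h s k δ hs hr).symm

/-- The action of `D_R` on a unit `R[F^e]`-module: `δ` acts through any level `er` to which it
belongs. -/
def diffOpAction (he : 0 < e) (h : IsUnitFrob F) : diffOp R p →+* AddMonoid.End M :=
  have key : ∀ (δ : diffOp R p) (r : ℕ) (hr : δ.1 ∈ diffOpLevel R p (e * r)),
      levelAction h (exists_level he δ).choose ⟨δ.1, (exists_level he δ).choose_spec⟩ =
        levelAction h r ⟨δ.1, hr⟩ := fun δ _ hr => levelAction_eq h δ.1 _ hr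
  have common : ∀ a b : diffOp R p, ∃ r, a.1 ∈ diffOpLevel R p (e * r) ∧
      b.1 ∈ diffOpLevel R p (e * r) := fun a b => by
    obtain ⟨r, hr⟩ := exists_level he a
    obtain ⟨s, hs⟩ := exists_level he b
    exact ⟨max r s, diffOpLevel_mono R p (Nat.mul_le_mul_left e (le_max_left r s)) hr,
      diffOpLevel_mono R p (Nat.mul_le_mul_left e (le_max_right r s)) hs⟩
  { toFun := fun δ =>
      levelAction h (exists_level he δ).choose ⟨δ.1, (exists_level he δ).choose_spec⟩
    map_one' := by
      rw [key 1 0 (one_mem _)]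
      refine addHom_ext_of_isUnitFrob 0 h fun a m => ?_
      rw [levelAction_smul_frobIter]
      rfl
    map_mul' := fun a b => by
      obtain ⟨r, ha, hb⟩ := common a b
      rw [key (a * b) r (mul_mem ha hb), key a r ha, key b r hb]
      refine addHom_ext_of_isUnitFrob r h fun c m => ?_
      change _ = levelAction h r ⟨a.1, ha⟩ (levelAction h r ⟨b.1, hb⟩ (c • frobIter F r m))
      rw [levelAction_smul_frobIter, levelAction_smul_frobIter, levelAction_smul_frobIter]
      rfl
    map_zero' := by
      rw [key 0 0 (zero_mem _)]
      refine addHom_ext_of_isUnitFrob 0 h fun a m => ?_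
      rw [levelAction_smul_frobIter]
      exact zero_smul R _
    map_add' := fun a b => by
      obtain ⟨r, ha, hb⟩ := common a b
      rw [key (a + b) r (add_mem ha hb), key a r ha, key b r hb]
      refine addHom_ext_of_isUnitFrob r h fun c m => ?_
      change _ = levelAction h r ⟨a.1, ha⟩ (c • frobIter F r m) +
        levelAction h r ⟨b.1, hb⟩ (c • frobIter F r m)
      rw [levelAction_smul_frobIter, levelAction_smul_frobIter, levelAction_smul_frobIter]
      exact add_smul _ _ _ }

theorem diffOpAction_eq_levelAction (he : 0 < e) (δ : diffOp R p) (r : ℕ)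
    (hr : δ.1 ∈ diffOpLevel R p (e * r)) :
    diffOpAction he h δ = levelAction h r ⟨δ.1, hr⟩ :=
  levelAction_eq h δ.1 _ hr

end Structure

section Submodule

variable {R : Type u} [CommRing R] {p : ℕ} [Fact p.Prime] [CharP R p] {e : ℕ}
variable {M : Type v} [AddCommGroup M] [Module R M] [Module (FrobRing R p e) M]
  [IsScalarTower R (FrobRing R p e) M]

/-- An `R[F^e]`-submodule `N` of a unit `R[F^e]`-module `M` is a *`D_R[F^e]`-submodule* if it is
also a `D_R`-submodule, for the action of `D_R` induced by the unit structure of `M`. -/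
def IsDiffOpFrobSubmodule (he : 0 < e) (hM : IsUnitFrob (frobAction R p e M))
    (N : Submodule (FrobRing R p e) M) : Prop :=
  ∀ δ : diffOp R p, ∀ m ∈ N, diffOpAction he hM δ m ∈ N

end Submodule

end FrobD

end

/-! Write F for F^e, R·F^r(A) for the R-span of F^r(A), and N_r = {x ∈ M : F^r(x) ∈ N}. By Kunz, R^n
is a finite projective right R-module, so it has a finite dual basis, which gives coordinate maps
c_i on M with m = ∑ x_i F^r(c_i(m)). Since R^n is faithfully flat, A ↦ R·F^r(A) commutes with
intersections, and F(x) ∈ R·F(A) forces x ∈ A.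

Frobenius descent: m ↦ F^r(c_i(m)) is the action of a differential operator, so it preserves N, and
therefore N = R·F^r(N_r) for every r (`le_frobSpan_comap_of_diffOpAction_mem`). It remains to see
that N_1 = N. A finitely generated M has a root A (`exists_isRoot`): a finitely generated
R-submodule with A ⊆ R·F(A) and M = ⋃ R·F^r(A). The chain A ∩ N_r increases because N is F-stable,
and it stabilizes because R is Noetherian. If F(x) ∈ N, then for all large r the element x lies in
R·F^r(A) and, by descent at level r + 1, in R·F^r(N_{r+1}). Hence x ∈ R·F^r(A ∩ N_{r+1}) = R·F^r(A ∩
N_r) ⊆ N. So N = R·F(N), which makes θ surjective on N; injectivity is flatness. Intersecting N =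
R·F^r(N) with R·F^r(A) shows that the finitely generated R-module N ∩ A generates N over R[F^e]. -/

/-! ### Regular local rings: regular sequences and a freeness criterion. -/

section RegularLocal

open IsLocalRing RingTheory.Sequence

/-- Cutting a regular local ring by an element of `𝔪 ∖ 𝔪²` gives a regular local ring whose
embedding dimension is smaller. -/
theorem IsRegularLocalRing.quotient_span_singleton {R : Type*} [CommRing R] [IsRegularLocalRing R]
    {x : R} (hx : x ∈ maximalIdeal R) (hx2 : x ∉ maximalIdeal R ^ 2) :
    ∃ _ : IsRegularLocalRing (R ⧸ Ideal.span {x}),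
      (maximalIdeal (R ⧸ Ideal.span {x})).spanFinrank + 1 ≤ (maximalIdeal R).spanFinrank := by
  have hne : Ideal.span {x} ≠ ⊤ := fun h => (mem_maximalIdeal x).mp hx
    (Ideal.span_singleton_eq_top.mp h)
  have : Nontrivial (R ⧸ Ideal.span {x}) := Ideal.Quotient.nontrivial_iff.mpr hne
  have hloc : IsLocalRing (R ⧸ Ideal.span {x}) :=
    .of_surjective' (Ideal.Quotient.mk _) Ideal.Quotient.mk_surjective
  have key : (maximalIdeal (R ⧸ Ideal.span {x})).spanFinrank + 1 ≤
      (maximalIdeal R).spanFinrank := by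
    let K := ResidueField R
    let C := CotangentSpace R
    let v : C := (maximalIdeal R).toCotangent ⟨x, hx⟩
    have hv : v ≠ 0 := by
      intro h
      exact hx2 ((Ideal.toCotangent_eq_zero _ _).mp h)
    have hrank := Submodule.finrank_quotient_add_finrank (Submodule.span K {v})
    rw [finrank_span_singleton hv] at hrank
    let b := Module.finBasis K (C ⧸ Submodule.span K {v})
    have hlift : ∀ i, ∃ y : maximalIdeal R,
        (Submodule.span K {v}).mkQ ((maximalIdeal R).toCotangent y) = b i := by
      intro i
      obtain ⟨c, hc⟩ := Submodule.mkQ_surjective (Submodule.span K {v}) (b i)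
      obtain ⟨y, rfl⟩ := (maximalIdeal R).toCotangent_surjective c
      exact ⟨y, hc⟩
    choose y hy using hlift
    -- By Nakayama, x together with lifts of a basis of the cotangent space modulo the class of x
    -- generates the maximal ideal.
    have hspan : Submodule.span R (insert ⟨x, hx⟩ (Set.range y)) =
        (⊤ : Submodule R (maximalIdeal R)) := by
      rw [← CotangentSpace.span_image_eq_top_iff, Set.image_insert_eq, Submodule.span_insert]
      have h1 : (Submodule.span K ((maximalIdeal R).toCotangent '' Set.range y)).map
          (Submodule.span K {v}).mkQ = ⊤ := by
        rw [Submodule.map_span, ← b.span_eq]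
        congr 1
        rw [← Set.range_comp, ← Set.range_comp]
        exact congrArg Set.range (funext hy)
      have h2 := congrArg (Submodule.comap (Submodule.span K {v}).mkQ) h1
      rwa [Submodule.comap_map_mkQ, Submodule.comap_top] at h2
    have hmax : maximalIdeal (R ⧸ Ideal.span {x}) =
        Ideal.span (Set.range fun i => Ideal.Quotient.mk (Ideal.span {x}) (y i : R)) := by
      have h0 : maximalIdeal R = Ideal.span (insert x (Set.range fun i => (y i : R))) := by
        have := congrArg (Submodule.map (maximalIdeal R).subtype) hspan
        rw [Submodule.map_span, Submodule.map_top, Submodule.range_subtype, Set.image_insert_eq,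
          ← Set.range_comp] at this
        exact this.symm
      have h1 : maximalIdeal (R ⧸ Ideal.span {x}) =
          (maximalIdeal R).map (Ideal.Quotient.mk (Ideal.span {x})) :=
        (IsLocalRing.map_maximalIdeal_of_surjective _ Ideal.Quotient.mk_surjective).symm
      rw [h1]
      refine (congrArg (Ideal.map _) h0).trans ?_
      rw [Ideal.map_span, Set.image_insert_eq, Ideal.span_insert,
        Ideal.Quotient.eq_zero_iff_mem.mpr (Ideal.mem_span_singleton_self x), ← Set.range_comp]
      simp
      rfl
    have hle : (maximalIdeal (R ⧸ Ideal.span {x})).spanFinrank ≤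
        Module.finrank K (C ⧸ Submodule.span K {v}) := by
      rw [hmax]
      refine (Submodule.spanFinrank_span_le_ncard_of_finite (Set.finite_range _)).trans ?_
      rw [← Set.image_univ]
      refine (Set.ncard_image_le Set.finite_univ).trans ?_
      rw [Set.ncard_univ, Nat.card_fin]
    rw [spanFinrank_maximalIdeal_eq_finrank_cotangentSpace R]
    change _ ≤ Module.finrank K C
    omega
  refine ⟨.of_spanFinrank_maximalIdeal_le _ ?_, key⟩
  -- The dimension drops by at most one and the embedding dimension by at least one, so the latter
  -- cannot exceed the former in the quotient.
  have h1 : ringKrullDim R ≤ ringKrullDim (R ⧸ Ideal.span {x}) + 1 := by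
    simpa using ringKrullDim_le_ringKrullDim_quotient_add_encard {x} (by
      rw [IsLocalRing.ringJacobson_eq_maximalIdeal]
      simpa using hx)
  have h2 : (((maximalIdeal (R ⧸ Ideal.span {x})).spanFinrank : WithBot ℕ∞)) + 1 ≤
      ringKrullDim (R ⧸ Ideal.span {x}) + 1 := by
    refine le_trans ?_ h1
    rw [← IsRegularLocalRing.spanFinrank_maximalIdeal]
    exact_mod_cast key
  exact (ENat.WithBot.add_le_add_natCast_right_iff (c := 1)).mp h2

/-- Prime avoidance gives x in 𝔪 outside 𝔪² and all minimal primes. By induction on the embedding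
dimension (x) is prime, and a minimal prime below it vanishes by Nakayama. -/
theorem IsRegularLocalRing.isDomain (R : Type*) [CommRing R] [IsRegularLocalRing R] :
    IsDomain R := by
  induction h : (maximalIdeal R).spanFinrank using Nat.strong_induction_on generalizing R with
  | _ n ih =>
  by_cases hfield : maximalIdeal R = ⊥
  · exact (IsLocalRing.isField_iff_maximalIdeal_eq.mpr hfield).isDomain
  have hdim : ringKrullDim R ≠ 0 := by
    rw [← IsRegularLocalRing.spanFinrank_maximalIdeal]
    intro h0
    exact hfield ((Submodule.spanFinrank_eq_zero_iff_eq_bot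
      (maximalIdeal R).fg_of_isNoetherianRing).mp (by exact_mod_cast h0))
  obtain ⟨x, hx, hx2, hxmin⟩ : ∃ x ∈ maximalIdeal R, x ∉ maximalIdeal R ^ 2 ∧
      ∀ P ∈ minimalPrimes R, x ∉ P := by
    by_contra! hcon
    have hfin : (insert (maximalIdeal R ^ 2) (minimalPrimes R)).Finite :=
      (minimalPrimes.finite_of_isNoetherianRing R).insert _
    -- Prime avoidance tolerates two non-prime ideals; 𝔪² fills both places.
    obtain ⟨I, hI, hle⟩ := (Ideal.subset_union_prime_finite hfin (f := id)
      (maximalIdeal R ^ 2) (maximalIdeal R ^ 2) (I := maximalIdeal R) (by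
        rintro I (rfl | hI) h1 _
        · exact absurd rfl h1
        · exact hI.1.1)).mp (by
        intro x hx
        by_cases h2 : x ∈ maximalIdeal R ^ 2
        · exact Set.mem_biUnion (Set.mem_insert _ _) h2
        · obtain ⟨P, hP, hxP⟩ := hcon x hx h2
          exact Set.mem_biUnion (Set.mem_insert_of_mem _ hP) hxP)
    rcases hI with rfl | hI
    · refine hfield (Submodule.eq_bot_of_le_smul_of_le_jacobson_bot (maximalIdeal R) _
        (maximalIdeal R).fg_of_isNoetherianRing ?_ (maximalIdeal_le_jacobson _))
      simpa [pow_two] using hle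
    · refine hdim ?_
      have : I.IsPrime := hI.1.1
      have hIm : I = maximalIdeal R := le_antisymm (le_maximalIdeal this.ne_top) hle
      rw [← maximalIdeal_height_eq_ringKrullDim, ← hIm,
        Ideal.height_eq_zero_iff.mpr hI]
      rfl
  obtain ⟨hreg, hlt⟩ := IsRegularLocalRing.quotient_span_singleton hx hx2
  have hdom : IsDomain (R ⧸ Ideal.span {x}) := ih _ (by omega) _ rfl
  have hprime : (Ideal.span {x}).IsPrime := (Ideal.Quotient.isDomain_iff_prime _).mp hdom
  obtain ⟨P, hP, hPle⟩ := Ideal.exists_minimalPrimes_le (bot_le : ⊥ ≤ Ideal.span {x})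
  have hPprime : P.IsPrime := hP.1.1
  -- P ⊆ (x) and x ∉ P give P = xP.
  have hPbot : P = ⊥ := by
    refine Submodule.eq_bot_of_le_smul_of_le_jacobson_bot (Ideal.span {x}) _
        P.fg_of_isNoetherianRing ?_
        (((Ideal.span_singleton_le_iff_mem _).mpr hx).trans (maximalIdeal_le_jacobson _))
    intro z hz
    obtain ⟨a, rfl⟩ := Ideal.mem_span_singleton.mp (hPle hz)
    exact Submodule.smul_mem_smul (Ideal.mem_span_singleton_self x)
      ((hPprime.mem_or_mem hz).resolve_left (hxmin P hP))
  have : (⊥ : Ideal R).IsPrime := hPbot ▸ hPprime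
  exact IsDomain.of_bot_isPrime R

/-- The maximal ideal of a regular local ring is generated by a regular sequence. -/
theorem IsRegularLocalRing.exists_isWeaklyRegular (R : Type*) [CommRing R] [IsRegularLocalRing R] :
    ∃ rs : List R, IsWeaklyRegular R rs ∧ Ideal.ofList rs = maximalIdeal R := by
  induction h : (maximalIdeal R).spanFinrank using Nat.strong_induction_on generalizing R with
  | _ n ih =>
  by_cases hfield : maximalIdeal R = ⊥
  · exact ⟨[], .nil _ _, by rw [hfield, Ideal.ofList_nil]⟩
  obtain ⟨x, hx, hx2⟩ : ∃ x ∈ maximalIdeal R, x ∉ maximalIdeal R ^ 2 := by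
    by_contra! hle
    refine hfield (Submodule.eq_bot_of_le_smul_of_le_jacobson_bot (maximalIdeal R) _
        (maximalIdeal R).fg_of_isNoetherianRing ?_ (maximalIdeal_le_jacobson _))
    rw [smul_eq_mul, ← pow_two]
    exact hle
  have := IsRegularLocalRing.isDomain R
  obtain ⟨hreg, hlt⟩ := IsRegularLocalRing.quotient_span_singleton hx hx2
  obtain ⟨rs, hrs, hmax⟩ := ih _ (by omega) (R ⧸ Ideal.span {x}) rfl
  obtain ⟨rs, rfl⟩ := (List.map_surjective_iff.mpr (Ideal.Quotient.mk_surjective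
    (I := Ideal.span {x}))) rs
  have hx0 : x ≠ 0 := fun h => hx2 (h ▸ zero_mem _)
  refine ⟨x :: rs, .cons (.of_ne_zero hx0) ?_, ?_⟩
  · let e : (R ⧸ Ideal.span {x}) ≃ₗ[R] QuotSMulTop x R :=
      Submodule.quotEquivOfEq _ _ (by simp [← Submodule.ideal_span_singleton_smul])
    rw [← e.isWeaklyRegular_congr, ← isWeaklyRegular_map_algebraMap_iff (R ⧸ Ideal.span {x})]
    exact hrs
  · rw [← Ideal.map_ofList] at hmax
    have := congrArg (Ideal.comap (Ideal.Quotient.mk (Ideal.span {x}))) hmax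
    rw [Ideal.comap_map_of_surjective _ Ideal.Quotient.mk_surjective, ← RingHom.ker_eq_comap_bot,
      Ideal.mk_ker, sup_comm, ← Ideal.ofList_cons] at this
    rw [this]
    have := IsLocalHom.of_surjective _ (Ideal.Quotient.mk_surjective (I := Ideal.span {x}))
    exact IsLocalRing.maximalIdeal_comap _

/-- Over a local ring a regular sequence in 𝔪 may be permuted, and its last element may be replaced
by a power. Each element is moved to the end, raised to the power `k`, and moved back. -/
theorem RingTheory.Sequence.IsWeaklyRegular.map_pow {R M : Type*} [CommRing R] [IsLocalRing R]
    [AddCommGroup M] [Module R M] [IsNoetherian R M] {rs : List R} (h : IsWeaklyRegular M rs)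
    (hrs : ∀ r ∈ rs, r ∈ maximalIdeal R) {k : ℕ} (hk : k ≠ 0) :
    IsWeaklyRegular M (rs.map (· ^ k)) := by
  -- `l₁` holds the elements already raised to the power `k`.
  have key : ∀ l₁ l₂ : List R, (∀ r ∈ l₁ ++ l₂, r ∈ maximalIdeal R) →
      IsWeaklyRegular M (l₁ ++ l₂) → IsWeaklyRegular M (l₁ ++ l₂.map (· ^ k)) := by
    intro l₁ l₂
    induction l₂ generalizing l₁ with
    | nil => intro _ h; simpa using h
    | cons a l ih =>
      intro hm h
      have h1 : IsWeaklyRegular M ((l₁ ++ l) ++ [a]) :=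
        isWeaklyRegular_of_perm_of_subset_maximalIdeal h
          (by simpa using List.perm_middle.trans (List.perm_append_singleton a (l₁ ++ l)).symm) hm
      rw [isWeaklyRegular_append_iff, isWeaklyRegular_singleton_iff] at h1
      have h2 : IsWeaklyRegular M ((l₁ ++ l) ++ [a ^ k]) := by
        rw [isWeaklyRegular_append_iff, isWeaklyRegular_singleton_iff]
        exact ⟨h1.1, h1.2.pow k⟩
      have hm' : ∀ r ∈ (l₁ ++ l) ++ [a ^ k], r ∈ maximalIdeal R := by
        intro r hr
        simp only [List.mem_append, List.mem_cons, List.not_mem_nil, or_false] at hr hm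
        rcases hr with (hr | hr) | rfl
        · exact hm r (Or.inl hr)
        · exact hm r (Or.inr (Or.inr hr))
        · exact Ideal.pow_mem_of_mem _ (hm a (by simp)) k (Nat.pos_of_ne_zero hk)
      have hperm : ((l₁ ++ l) ++ [a ^ k]).Perm ((l₁ ++ [a ^ k]) ++ l) := by
        rw [List.append_assoc, List.append_assoc]
        exact List.perm_append_comm.append_left l₁
      have h3 := isWeaklyRegular_of_perm_of_subset_maximalIdeal h2 hperm hm'
      simpa using ih (l₁ ++ [a ^ k]) (fun r hr => hm' r (hperm.mem_iff.mpr hr)) h3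
  simpa using key [] rs hrs h

/-- A finite module on which a generating sequence of the maximal ideal is weakly regular is
free. -/
theorem Module.Free.of_isWeaklyRegular_of_ofList_eq_maximalIdeal {R M : Type*} [CommRing R]
    [IsLocalRing R] [IsNoetherianRing R] [AddCommGroup M] [Module R M] [Module.Finite R M]
    {rs : List R} (h : IsWeaklyRegular M rs) (hrs : Ideal.ofList rs = maximalIdeal R) :
    Module.Free R M := by
  induction hn : rs.length generalizing R M rs with
  | zero =>
    rw [List.length_eq_zero_iff] at hn
    subst hn
    let := (IsLocalRing.isField_iff_maximalIdeal_eq.mpr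
      (hrs.symm.trans Ideal.ofList_nil)).toField
    exact Module.Free.of_divisionRing R M
  | succ n ih =>
    obtain ⟨x, rs, rfl⟩ := List.exists_cons_of_length_eq_add_one hn
    have hx : x ∈ maximalIdeal R := hrs ▸ Ideal.subset_span List.mem_cons_self
    rw [isWeaklyRegular_cons_iff'] at h
    have hne : Ideal.span {x} ≠ ⊤ := fun h => (mem_maximalIdeal x).mp hx
      (Ideal.span_singleton_eq_top.mp h)
    have : Nontrivial (R ⧸ Ideal.span {x}) := Ideal.Quotient.nontrivial_iff.mpr hne
    have hloc : IsLocalRing (R ⧸ Ideal.span {x}) :=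
      .of_surjective' (Ideal.Quotient.mk _) Ideal.Quotient.mk_surjective
    have := Module.finitePresentation_of_finite R M
    have := Module.Finite.of_restrictScalars_finite R (R ⧸ Ideal.span {x}) (QuotSMulTop x M)
    -- Freeness descends from M/xM over R/(x) because x is regular on M, which leaves a shorter
    -- sequence.
    rw [← Module.free_quotSMulTop_iff_free R M (maximalIdeal_le_jacobson _ hx) h.1]
    refine ih h.2 ?_ (by simpa using hn)
    rw [← Ideal.map_ofList, ← IsLocalRing.map_maximalIdeal_of_surjective
      (Ideal.Quotient.mk (Ideal.span {x})) Ideal.Quotient.mk_surjective, ← hrs, Ideal.ofList_cons,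
      Ideal.map_sup, Ideal.map_quotient_self, bot_sup_eq]

end RegularLocal

/-! ### Kunz's theorem: Frobenius is flat on an F-finite regular ring. -/

namespace FrobD
universe u v
section Kunz

open IsLocalRing RingTheory.Sequence

variable (R : Type u) [CommRing R] (p : ℕ) [Fact p.Prime] [CharP R p]

theorem finite_iterateFrobenius (hF : (frobenius R p).Finite) (n : ℕ) :
    (iterateFrobenius R p n).Finite := by
  induction n with
  | zero => rw [iterateFrobenius_zero]; exact .id R
  | succ n ih => rw [iterateFrobenius_add, iterateFrobenius_one]; exact ih.comp hF

/-- Kunz: a power of the Frobenius endomorphism of an `F`-finite regular local ring is free. -/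
theorem free_frobTwist_of_isRegularLocalRing [IsRegularLocalRing R] (n : ℕ)
    [Module.Finite R (FrobTwist R p n)] : Module.Free R (FrobTwist R p n) := by
  obtain ⟨rs, hrs, hmax⟩ := IsRegularLocalRing.exists_isWeaklyRegular R
  have hmem : ∀ r ∈ rs, r ∈ maximalIdeal R := fun r hr => hmax ▸ Ideal.subset_span hr
  refine .of_isWeaklyRegular_of_ofList_eq_maximalIdeal (rs := rs) ?_ hmax
  have hq : p ^ n ≠ 0 := pow_ne_zero _ (Fact.out : p.Prime).ne_zero
  -- An element r acts on R^n as r^(p^n) acts on R, so the sequence to test on R is that of the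
  -- p^n-th powers.
  refine (AddEquiv.isWeaklyRegular_congr (e := (twist (R := R) p n).symm.toAddEquiv)
    (List.forall₂_map_right_iff.mpr (List.forall₂_same.mpr fun r _ x => ?_))).mpr
    (hrs.map_pow hmem hq)
  rfl

theorem finite_frobTwist_of_isLocalization (S : Submonoid R) (A : Type*) [CommRing A]
    [Algebra R A] [IsLocalization S A] [CharP A p] (n : ℕ) [Module.Finite R (FrobTwist R p n)] :
    Module.Finite A (FrobTwist A p n) := by
  obtain ⟨s, hs⟩ := Module.Finite.fg_top (R := R) (M := FrobTwist R p n)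
  let g : FrobTwist R p n →ₛₗ[algebraMap R A] FrobTwist A p n :=
    { toFun a := twist p n (algebraMap R A ((twist p n).symm a))
      map_add' a b := map_add (algebraMap R A) a b
      map_smul' r a := by
        change algebraMap R A (r ^ p ^ n * (twist p n).symm a) =
          algebraMap R A r ^ p ^ n * algebraMap R A ((twist p n).symm a)
        rw [map_mul, map_pow] }
  let N := Submodule.span A (g '' s)
  have hN : ∀ a, g a ∈ N := by
    have : (⊤ : Submodule R (FrobTwist R p n)) ≤ N.comap g := by
      rw [← hs, Submodule.span_le]
      exact fun a ha => Submodule.subset_span (Set.mem_image_of_mem _ ha)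
    exact fun a => this trivial
  refine ⟨Submodule.fg_def.mpr ⟨g '' s, s.finite_toSet.image _, eq_top_iff.mpr fun z _ => ?_⟩⟩
  obtain ⟨z, rfl⟩ := (twist (R := A) p n).surjective z
  obtain ⟨a, t, rfl⟩ := IsLocalization.exists_mk'_eq S z
  have hq : p ^ n ≠ 0 := pow_ne_zero _ (Fact.out : p.Prime).ne_zero
  -- With q = p^n, a/t = (1/t)^q · t^(q-1)a: the twisted action of 1/t on an element coming from R.
  have := N.smul_mem (IsLocalization.mk' A (1 : R) t) (hN (twist p n (t ^ (p ^ n - 1) * a)))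
  convert this using 1
  change IsLocalization.mk' A a t = IsLocalization.mk' A (1 : R) t ^ p ^ n *
    algebraMap R A (t ^ (p ^ n - 1) * a)
  rw [IsLocalization.mk'_eq_iff_eq_mul]
  have h1 : IsLocalization.mk' A (1 : R) t * algebraMap R A t = 1 := by
    rw [IsLocalization.mk'_spec, map_one]
  calc algebraMap R A a = (IsLocalization.mk' A (1 : R) t * algebraMap R A t) ^ p ^ n *
        algebraMap R A a := by rw [h1, one_pow, one_mul]
    _ = _ := by
      rw [map_mul, map_pow, mul_pow, ← pow_sub_one_mul hq (algebraMap R A t)]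
      ring

/-- Flatness is local; Frobenius contracts every prime to itself and localizes to the Frobenius of
the local ring, where it is free. -/
theorem flat_iterateFrobenius [IsRegularRing R] (hF : (frobenius R p).Finite) (n : ℕ) :
    (iterateFrobenius R p n).Flat := by
  have hfin : Module.Finite R (FrobTwist R p n) := finite_iterateFrobenius R p hF n
  -- The contraction of P equals P only propositionally, so it is a separate variable Q that can be
  -- substituted.
  have key : ∀ (P Q : Ideal R) [P.IsPrime] [Q.IsPrime] (hQ : Q = P.comap (iterateFrobenius R p n)),
      Q = P → (Localization.localRingHom Q P (iterateFrobenius R p n) hQ).Flat := by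
    intro P Q _ _ hQ hQP
    subst hQP
    have : CharP (Localization.AtPrime Q) p := (CharP.charP_iff_prime_eq_zero Fact.out).mpr (by
      rw [← map_natCast (algebraMap R (Localization.AtPrime Q)), CharP.cast_eq_zero, map_zero])
    rw [Localization.localRingHom_unique Q Q (iterateFrobenius R p n) hQ
      (j := iterateFrobenius (Localization.AtPrime Q) p n) fun x => by
        simp only [iterateFrobenius_def, map_pow]]
    have := finite_frobTwist_of_isLocalization R p Q.primeCompl (Localization.AtPrime Q) n
    have := free_frobTwist_of_isRegularLocalRing (Localization.AtPrime Q) p n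
    exact (inferInstance : Module.Flat (Localization.AtPrime Q)
      (FrobTwist (Localization.AtPrime Q) p n))
  refine RingHom.Flat.ofLocalizationPrime _ fun P _ => key P _ rfl ?_
  ext x
  rw [Ideal.mem_comap, iterateFrobenius_def]
  exact Ideal.IsPrime.pow_mem_iff_mem ‹_› _ (pow_pos (Fact.out : p.Prime).pos n)

theorem projective_frobTwist [IsRegularRing R] (hF : (frobenius R p).Finite) (n : ℕ) :
    Module.Projective R (FrobTwist R p n) := by
  have h1 : Module.Finite R (FrobTwist R p n) := finite_iterateFrobenius R p hF n
  have h2 : Module.Flat R (FrobTwist R p n) := flat_iterateFrobenius R p hF n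
  have := Module.finitePresentation_of_finite R (FrobTwist R p n)
  exact Module.Flat.projective_of_finitePresentation

end Kunz
end FrobD

/-! ### Submodules generated by Frobenius images, and roots. -/

namespace FrobD
universe u v

section FrobSpan

variable {R : Type u} [CommRing R] {p : ℕ} [Fact p.Prime] [CharP R p]
variable {M : Type v} [AddCommGroup M] [Module R M]

/-- The `R`-submodule generated by the image of `A` under a `p^n`-linear map. -/
def frobSpan {n : ℕ} (G : M →ₛₗ[iterateFrobenius R p n] M) (A : Submodule R M) : Submodule R M :=
  Submodule.span R (G '' A)

section
variable {n : ℕ} (G : M →ₛₗ[iterateFrobenius R p n] M) {A B : Submodule R M}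

theorem mem_frobSpan_of_mem {x : M} (hx : x ∈ A) : G x ∈ frobSpan G A :=
  Submodule.subset_span (Set.mem_image_of_mem G hx)

theorem frobSpan_le : frobSpan G A ≤ B ↔ ∀ x ∈ A, G x ∈ B := by
  rw [frobSpan, Submodule.span_le, Set.image_subset_iff]
  rfl

theorem frobSpan_mono (h : A ≤ B) : frobSpan G A ≤ frobSpan G B :=
  (frobSpan_le G).mpr fun _ hx => mem_frobSpan_of_mem G (h hx)

theorem frobSpan_span (s : Set M) :
    frobSpan G (Submodule.span R s) = Submodule.span R (G '' s) := by
  refine le_antisymm ((frobSpan_le G).mpr fun x hx => ?_)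
    (Submodule.span_mono (Set.image_mono Submodule.subset_span))
  induction hx using Submodule.span_induction with
  | mem x hx => exact Submodule.subset_span (Set.mem_image_of_mem G hx)
  | zero => rw [map_zero]; exact zero_mem _
  | add x y _ _ hx hy => rw [map_add]; exact add_mem hx hy
  | smul a x _ hx => rw [LinearMap.map_smulₛₗ]; exact Submodule.smul_mem _ _ hx

theorem fg_frobSpan (hA : A.FG) : (frobSpan G A).FG := by
  obtain ⟨s, hs, rfl⟩ := Submodule.fg_def.mp hA
  rw [frobSpan_span]
  exact Submodule.fg_def.mpr ⟨_, hs.image G, rfl⟩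

theorem structureMap_mem_frobSpan_top (t : FrobTwist R p n ⊗[R] M) : structureMap G t ∈ frobSpan G ⊤ := by
  induction t using TensorProduct.induction_on with
  | zero => rw [map_zero]; exact zero_mem _
  | tmul a m => exact Submodule.smul_mem _ _ (mem_frobSpan_of_mem G trivial)
  | add x y hx hy => rw [map_add]; exact add_mem hx hy

theorem structureMap_surjective_iff :
    Function.Surjective (structureMap G) ↔ frobSpan G ⊤ = ⊤ := by
  refine ⟨fun h => eq_top_iff.mpr fun m _ => ?_, fun h m => ?_⟩
  · obtain ⟨t, rfl⟩ := h m
    exact structureMap_mem_frobSpan_top G t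
  · have hm : m ∈ frobSpan G ⊤ := by rw [h]; trivial
    induction hm using Submodule.span_induction with
    | mem x hx =>
      obtain ⟨y, -, rfl⟩ := hx
      exact ⟨twist p n 1 ⊗ₜ[R] y, by rw [structureMap_tmul, one_smul]⟩
    | zero => exact ⟨0, map_zero _⟩
    | add x y _ _ hx hy =>
      obtain ⟨s, rfl⟩ := hx
      obtain ⟨t, rfl⟩ := hy
      exact ⟨s + t, map_add _ s t⟩
    | smul a x _ hx =>
      obtain ⟨t, rfl⟩ := hx
      exact ⟨leftMul n a t, structureMap_leftMul G a t⟩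

end

section Iterate
variable {e : ℕ} (F : M →ₛₗ[iterateFrobenius R p e] M) (A : Submodule R M)

theorem frobSpan_frobIter_zero : frobSpan (frobIter F 0) A = A := by
  refine le_antisymm ((frobSpan_le _).mpr fun x hx => hx) fun x hx => ?_
  exact mem_frobSpan_of_mem (frobIter F 0) hx

theorem frobSpan_frobIter_succ (r : ℕ) :
    frobSpan (frobIter F (r + 1)) A = frobSpan F (frobSpan (frobIter F r) A) := by
  conv_rhs => rw [frobSpan.eq_def (frobIter F r)]
  rw [frobSpan_span, Set.image_image]
  exact congrArg _ (Set.image_congr fun x _ => frobIter_succ F r x)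

theorem frobSpan_frobIter_succ' (r : ℕ) :
    frobSpan (frobIter F (r + 1)) A = frobSpan (frobIter F r) (frobSpan F A) := by
  conv_rhs => rw [frobSpan.eq_def F]
  rw [frobSpan_span, Set.image_image]
  exact congrArg (Submodule.span R) (Set.image_congr fun x _ => Function.iterate_succ_apply F r x)

theorem monotone_frobSpan_frobIter (hA : A ≤ frobSpan F A) :
    Monotone fun r => frobSpan (frobIter F r) A :=
  monotone_nat_of_le_succ fun r => by
    rw [frobSpan_frobIter_succ']
    exact frobSpan_mono _ hA

/-- A finitely generated submodule `A ⊆ M` is a root of `M` if `A` is contained in the submodule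
generated by `F(A)`, and the submodules generated by `F^r(A)` exhaust `M`. -/
structure IsRoot : Prop where
  fg : A.FG
  le_frobSpan : A ≤ frobSpan F A
  exhaust : ∀ m, ∃ r, m ∈ frobSpan (frobIter F r) A

end Iterate

/-! ### Dual bases and coordinates on a unit module. -/

section DualBasis

/-- A finite dual basis for the `n`-th power of the Frobenius endomorphism of `R`: every `a` is
`∑ i, φ i a ^ p ^ n * x i`. -/
structure FrobDualBasis (R : Type u) [CommRing R] (p n : ℕ) [Fact p.Prime] [CharP R p] where
  card : ℕ
  vec : Fin card → R
  coord : Fin card → FrobTwist R p n →ₗ[R] R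
  sum_eq : ∀ a : R, ∑ i, coord i (twist p n a) ^ p ^ n * vec i = a

theorem nonempty_frobDualBasis (n : ℕ) [Module.Finite R (FrobTwist R p n)]
    [Module.Projective R (FrobTwist R p n)] : Nonempty (FrobDualBasis R p n) := by
  obtain ⟨k, f, g, -, -, hfg⟩ := Module.Finite.exists_comp_eq_id_of_projective R (FrobTwist R p n)
  refine ⟨⟨k, fun i => (twist p n).symm (f (Pi.single i 1)), fun i => LinearMap.proj i ∘ₗ g,
    fun a => ?_⟩⟩
  have h := LinearMap.congr_fun hfg (twist p n a)
  have h2 : g (twist p n a) = ∑ i, g (twist p n a) i • (Pi.single i 1 : Fin k → R) := by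
    rw [← pi_eq_sum_univ' (g (twist p n a))]
  rw [LinearMap.comp_apply, h2, map_sum] at h
  simp only [map_smul] at h
  exact h

namespace FrobDualBasis

variable {n : ℕ} (b : FrobDualBasis R p n)
variable {G : M →ₛₗ[iterateFrobenius R p n] M} (h : IsUnitFrob G)

/-- The coordinates of elements of a unit module with respect to a dual basis, characterized by
`coordMap (a • G m) = coord a • m`. -/
noncomputable def coordMap (i : Fin b.card) : M →+ M :=
  ((TensorProduct.lid R M).toLinearMap ∘ₗ
    (b.coord i).rTensor M).toAddMonoidHom.comp (AddEquiv.ofBijective _ h).symm.toAddMonoidHom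

theorem coordMap_smul (i : Fin b.card) (a : R) (m : M) :
    b.coordMap h i (a • G m) = b.coord i (twist p n a) • m := by
  have : (AddEquiv.ofBijective _ h).symm (a • G m) = twist p n a ⊗ₜ[R] m := by
    rw [AddEquiv.symm_apply_eq]; rfl
  change TensorProduct.lid R M ((b.coord i).rTensor M
    ((AddEquiv.ofBijective _ h).symm (a • G m))) = _
  rw [this]
  rfl

theorem coordMap_mem_of_mem_frobSpan (i : Fin b.card) {A : Submodule R M} {m : M}
    (hm : m ∈ frobSpan G A) : b.coordMap h i m ∈ A := by
  -- `coordMap` is additive but not R-linear, so the span induction needs all multiples of m at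
  -- once.
  have : ∀ c : R, b.coordMap h i (c • m) ∈ A := by
    induction hm using Submodule.span_induction with
    | mem x hx =>
      obtain ⟨y, hy, rfl⟩ := hx
      intro c
      rw [coordMap_smul]
      exact A.smul_mem _ hy
    | zero => intro c; rw [smul_zero, map_zero]; exact zero_mem _
    | add x y _ _ hx hy => intro c; rw [smul_add, map_add]; exact add_mem (hx c) (hy c)
    | smul a x _ hx => intro c; rw [smul_smul]; exact hx _
  simpa using this 1

theorem sum_coordMap (m : M) : ∑ i, b.vec i • G (b.coordMap h i m) = m := by
  have hm : m ∈ frobSpan G ⊤ := by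
    rw [(structureMap_surjective_iff G).mp h.2]; trivial
  have : ∀ c : R, ∑ i, b.vec i • G (b.coordMap h i (c • m)) = c • m := by
    induction hm using Submodule.span_induction with
    | mem x hx =>
      obtain ⟨y, hy, rfl⟩ := hx
      intro c
      conv_rhs => rw [← b.sum_eq c, Finset.sum_smul]
      refine Finset.sum_congr rfl fun i _ => ?_
      rw [coordMap_smul, LinearMap.map_smulₛₗ, smul_smul, iterateFrobenius_def, mul_comm]
    | zero => intro c; simp
    | add x y _ _ hx hy =>
      intro c
      simp only [smul_add, map_add, Finset.sum_add_distrib, hx, hy]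
    | smul a x _ hx => intro c; rw [smul_smul]; exact hx _
  simpa using this 1

include b h in
-- This is faithful flatness: the coordinates of G(x) are multiples of x by the coordinates of 1,
-- and the latter generate the unit ideal.
theorem mem_of_apply_mem_frobSpan {A : Submodule R M} {x : M} (hx : G x ∈ frobSpan G A) :
    x ∈ A := by
  have h1 : ∀ i, b.coord i (twist p n 1) • x ∈ A := fun i => by
    rw [← b.coordMap_smul h, one_smul]
    exact b.coordMap_mem_of_mem_frobSpan h i hx
  rw [← one_smul R x, ← b.sum_eq 1, Finset.sum_smul]
  refine sum_mem fun i _ => ?_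
  rw [← pow_sub_one_mul (pow_ne_zero n (Fact.out : p.Prime).ne_zero), mul_right_comm, mul_smul]
  exact A.smul_mem _ (h1 i)

include b h in
-- An element is recovered from its coordinates, and these lie in A and in B.
theorem frobSpan_inf (A B : Submodule R M) : frobSpan G A ⊓ frobSpan G B ≤ frobSpan G (A ⊓ B) := by
  rintro m ⟨hA, hB⟩
  rw [← b.sum_coordMap h m]
  exact sum_mem fun i _ => Submodule.smul_mem _ _ (mem_frobSpan_of_mem G
    ⟨b.coordMap_mem_of_mem_frobSpan h i hA, b.coordMap_mem_of_mem_frobSpan h i hB⟩)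

/-- The differential operator `a ↦ coord a ^ p ^ n` attached to a dual basis. -/
def diffOpLevel (i : Fin b.card) : FrobD.diffOpLevel R p n :=
  ⟨((iterateFrobenius R p n : R →+* R) : R →+ R).comp
      ((b.coord i).toAddMonoidHom.comp (twist (R := R) p n).toAddMonoidHom), fun r x => by
    change iterateFrobenius R p n (b.coord i (r • twist p n x)) =
      r ^ p ^ n * iterateFrobenius R p n (b.coord i (twist p n x))
    rw [map_smul, smul_eq_mul, map_mul, iterateFrobenius_def]⟩

/-- This is the link between D_R-stability and coordinates: taking a coordinate and applying F^r is
a differential operator. -/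
theorem levelAction_diffOpLevel {e r : ℕ} (b : FrobDualBasis R p (e * r))
    {F : M →ₛₗ[iterateFrobenius R p e] M} (h : IsUnitFrob F) (i : Fin b.card) (m : M) :
    levelAction h r (b.diffOpLevel i) m = frobIter F r (b.coordMap (h.iter r) i m) := by
  have : levelAction h r (b.diffOpLevel i) =
      ((frobIter F r).toAddMonoidHom.comp (b.coordMap (h.iter r) i) : M →+ M) := by
    refine addHom_ext_of_isUnitFrob r h fun a m => ?_
    rw [levelAction_smul_frobIter]
    change iterateFrobenius R p (e * r) (b.coord i (twist p (e * r) a)) • frobIter F r m =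
      frobIter F r (b.coordMap (h.iter r) i (a • frobIter F r m))
    rw [coordMap_smul, LinearMap.map_smulₛₗ]
  exact DFunLike.congr_fun this m

end FrobDualBasis

end DualBasis

/-! ### Frobenius descent and the stabilization argument. -/

section Descent

variable {e : ℕ} {F : M →ₛₗ[iterateFrobenius R p e] M}

/-- Frobenius descent: a `D_R`-submodule `N` of a unit module is generated by the
`F^r(m) ∈ N`. -/
theorem le_frobSpan_comap_of_diffOpAction_mem (he : 0 < e) (h : IsUnitFrob F)
    {N : Submodule R M} (hN : ∀ δ : diffOp R p, ∀ m ∈ N, diffOpAction he h δ m ∈ N) {r : ℕ}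
    (b : FrobDualBasis R p (e * r)) :
    N ≤ frobSpan (frobIter F r) (N.comap (frobIter F r)) := by
  intro m hm
  rw [← b.sum_coordMap (h.iter r) m]
  refine sum_mem fun i _ => Submodule.smul_mem _ _ (mem_frobSpan_of_mem _ ?_)
  rw [Submodule.mem_comap, ← b.levelAction_diffOpLevel h]
  have := hN ⟨(b.diffOpLevel i).1, _, (b.diffOpLevel i).2⟩ m hm
  rwa [diffOpAction_eq_levelAction h he _ r (b.diffOpLevel i).2] at this

variable (b : ∀ n, FrobDualBasis R p n) (h : IsUnitFrob F) {N A : Submodule R M}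
  (hNF : ∀ m ∈ N, F m ∈ N)
  (hN : ∀ r, N ≤ frobSpan (frobIter F r) (N.comap (frobIter F r)))
include b h hNF hN

/-- This is N_1 = N, the heart of the proof: on the root, the increasing chain A ∩ N_r stabilizes,
and descent at a high level r + 1 carries this back to N. -/
theorem mem_of_apply_mem_of_isRoot [IsNoetherianRing R] (hA : IsRoot F A) {x : M}
    (hx : F x ∈ N) : x ∈ N := by
  have : Module.Finite R A := Module.Finite.iff_fg.mpr hA.fg
  let f : ℕ →o Submodule R A :=
    ⟨fun r => (N.comap (frobIter F r)).comap A.subtype, monotone_nat_of_le_succ fun r y hy => by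
      change frobIter F (r + 1) y ∈ N
      rw [frobIter_succ]
      exact hNF _ hy⟩
  obtain ⟨k, hk⟩ := monotone_stabilizes_iff_noetherian.mpr (inferInstanceAs (IsNoetherian R A)) f
  obtain ⟨s, hs⟩ := hA.exhaust x
  let r := max k s
  have hxr : x ∈ frobSpan (frobIter F r) A :=
    monotone_frobSpan_frobIter F A hA.le_frobSpan (le_max_right k s) hs
  -- F(x) lies in R·F^(r+1)(N_{r+1}) = R·F(R·F^r(N_{r+1})), and the outer F cancels.
  have hx1 : x ∈ frobSpan (frobIter F r) (N.comap (frobIter F (r + 1))) := by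
    refine (b e).mem_of_apply_mem_frobSpan h ?_
    rw [← frobSpan_frobIter_succ]
    exact hN (r + 1) hx
  have hx2 := (b (e * r)).frobSpan_inf (h.iter r) _ _ ⟨hx1, hxr⟩
  refine (frobSpan_le _).mpr (fun y hy => ?_) hx2
  have h1 : f r = f (r + 1) :=
    (hk r (le_max_left k s)).symm.trans (hk (r + 1) ((le_max_left k s).trans r.le_succ))
  have h2 : (⟨y, hy.2⟩ : A) ∈ f (r + 1) := hy.1
  rw [← h1] at h2
  exact h2

theorem exists_mem_frobSpan_inf_of_isRoot [IsNoetherianRing R] (hA : IsRoot F A) {m : M}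
    (hm : m ∈ N) : ∃ r, m ∈ frobSpan (frobIter F r) (N ⊓ A) := by
  obtain ⟨r, hr⟩ := hA.exhaust m
  refine ⟨r, frobSpan_mono _ ?_ ((b (e * r)).frobSpan_inf (h.iter r) _ _ ⟨hN r hm, hr⟩)⟩
  -- N_r ⊆ N, by removing one F at a time.
  refine inf_le_inf_right _ fun y hy => ?_
  rw [Submodule.mem_comap] at hy
  clear hr
  induction r with
  | zero => exact hy
  | succ r ih =>
    rw [frobIter_succ] at hy
    exact ih (mem_of_apply_mem_of_isRoot b h hNF hN hA hy)

end Descent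

end FrobSpan

end FrobD

/-! ### Existence of roots, and passage to R[F^e]-submodules. -/

namespace FrobD
universe u v

section FrobRing

variable {R : Type u} [CommRing R] {p : ℕ} [Fact p.Prime] [CharP R p] {e : ℕ}

theorem FrobRing.induction {P : FrobRing R p e → Prop} (g : FrobRing R p e)
    (one : P 1) (add : ∀ a b, P a → P b → P (a + b)) (smul : ∀ (r : R) a, P a → P (r • a))
    (mul : ∀ a, P a → P (frobVar R p e * a)) : P g := by
  let := frobMulSemiringAction R p e
  have hpow : ∀ n : ℕ, P (frobVar R p e ^ n) := by
    intro n
    induction n with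
    | zero => rw [pow_zero]; exact one
    | succ n ih => rw [pow_succ']; exact mul _ ih
  have hzero : P 0 := by
    have := smul 0 1 one
    rwa [zero_smul] at this
  refine SkewPolynomial.induction (motive := P) g hzero fun n r q _ _ hq => add _ _ ?_ hq
  rw [← SkewPolynomial.smul_X_eq_monomial]
  exact smul r _ (hpow n)

variable {M : Type v} [AddCommGroup M] [Module R M] [Module (FrobRing R p e) M]
  [IsScalarTower R (FrobRing R p e) M]

/-- An `R`-submodule stable under the Frobenius action is an `R[F^e]`-submodule. -/
def frobSubmodule (U : Submodule R M) (hU : ∀ m ∈ U, frobAction R p e M m ∈ U) :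
    Submodule (FrobRing R p e) M :=
  { U with
    smul_mem' := fun g m hm => by
      change g • m ∈ U
      induction g using FrobRing.induction with
      | one => rwa [one_smul]
      | add a b ha hb => rw [add_smul]; exact add_mem ha hb
      | smul r a ha => rw [smul_assoc]; exact U.smul_mem r ha
      | mul a ha => rw [mul_smul]; exact hU _ ha }

/-- Let L_k be the R-span of the F^i(T), i ≤ k, for a finite generating set T. The L_k exhaust M,
hence so do the R·F(L_k) when θ is surjective. Once T ⊆ R·F(L_k), the module L_k is a root. -/
theorem exists_isRoot (hM : Function.Surjective (structureMap (frobAction R p e M)))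
    [hfg : Module.Finite (FrobRing R p e) M] :
    ∃ A : Submodule R M, IsRoot (frobAction R p e M) A := by
  let F := frobAction R p e M
  obtain ⟨T, hT⟩ := hfg.fg_top
  let L : ℕ → Submodule R M := fun k =>
    Nat.rec (Submodule.span R T) (fun _ A => A ⊔ frobSpan F A) k
  have hL : ∀ k, L (k + 1) = L k ⊔ frobSpan F (L k) := fun _ => rfl
  have hmono : Monotone L := monotone_nat_of_le_succ fun k => hL k ▸ le_sup_left
  have hfgL : ∀ k, (L k).FG := by
    intro k
    induction k with
    | zero => exact ⟨T, rfl⟩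
    | succ k ih => exact hL k ▸ ih.sup (fg_frobSpan F ih)
  have hex : ∀ m, ∃ k, m ∈ L k := by
    let U := frobSubmodule (p := p) (e := e) (⨆ k, L k) fun m hm => by
      rw [Submodule.mem_iSup_of_directed _ hmono.directed_le] at hm ⊢
      obtain ⟨k, hk⟩ := hm
      exact ⟨k + 1, hL k ▸ Submodule.mem_sup_right (mem_frobSpan_of_mem F hk)⟩
    have hU : (⊤ : Submodule (FrobRing R p e) M) ≤ U := by
      rw [← hT, Submodule.span_le]
      exact fun t ht => Submodule.mem_iSup_of_mem (p := L) 0 (Submodule.subset_span ht)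
    intro m
    have hm : m ∈ ⨆ k, L k := hU trivial
    rwa [Submodule.mem_iSup_of_directed _ hmono.directed_le] at hm
  have hexF : ∀ m, ∃ k, m ∈ frobSpan F (L k) := by
    intro m
    have hm : m ∈ frobSpan F ⊤ := by
      rw [(structureMap_surjective_iff F).mp hM]; trivial
    induction hm using Submodule.span_induction with
    | mem x hx =>
      obtain ⟨y, -, rfl⟩ := hx
      obtain ⟨k, hk⟩ := hex y
      exact ⟨k, mem_frobSpan_of_mem F hk⟩
    | zero => exact ⟨0, zero_mem _⟩
    | add x y _ _ hx hy =>
      obtain ⟨k, hk⟩ := hx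
      obtain ⟨l, hl⟩ := hy
      exact ⟨max k l, add_mem (frobSpan_mono F (hmono (le_max_left k l)) hk)
        (frobSpan_mono F (hmono (le_max_right k l)) hl)⟩
    | smul a x _ hx =>
      obtain ⟨k, hk⟩ := hx
      exact ⟨k, Submodule.smul_mem _ a hk⟩
  choose κ hκ using hexF
  -- A common stage for the finitely many generators.
  let k := T.sup κ
  have hroot : ∀ j ≤ k, L j ≤ frobSpan F (L k) := by
    intro j hj
    induction j with
    | zero =>
      refine Submodule.span_le.mpr fun t ht => ?_
      exact frobSpan_mono F (hmono (Finset.le_sup (f := κ) ht)) (hκ t)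
    | succ j ih =>
      rw [hL]
      exact sup_le (ih (by omega)) (frobSpan_mono F (hmono (by omega)))
  refine ⟨L k, hfgL k, hroot k le_rfl, fun m => ?_⟩
  have hSmono := monotone_frobSpan_frobIter F (L k) (hroot k le_rfl)
  have hle : ∀ j, ∃ r, L j ≤ frobSpan (frobIter F r) (L k) := by
    intro j
    induction j with
    | zero => exact ⟨0, by rw [frobSpan_frobIter_zero]; exact hmono (Nat.zero_le k)⟩
    | succ j ih =>
      obtain ⟨r, hr⟩ := ih
      refine ⟨r + 1, hL j ▸ sup_le (hr.trans (hSmono r.le_succ)) ?_⟩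
      rw [frobSpan_frobIter_succ]
      exact frobSpan_mono F hr
  obtain ⟨j, hj⟩ := hex m
  obtain ⟨r, hr⟩ := hle j
  exact ⟨r, hr hj⟩

variable (N : Submodule (FrobRing R p e) M)

theorem structureMap_subtype (t : FrobTwist R p e ⊗[R] N) :
    structureMap (frobAction R p e M)
      (((N.subtype.restrictScalars R).lTensor (FrobTwist R p e)) t) =
      (structureMap (frobAction R p e N) t : M) := by
  induction t using TensorProduct.induction_on with
  | zero => simp
  | tmul a m => rfl
  | add x y hx hy => simp only [map_add, hx, hy, Submodule.coe_add]

/-- Injectivity passes from M to N because R^e is flat; the inclusion `hN` is surjectivity. -/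
theorem isUnitFrob_submodule [Module.Flat R (FrobTwist R p e)]
    (hM : IsUnitFrob (frobAction R p e M))
    (hN : N.restrictScalars R ≤ frobSpan (frobAction R p e M) (N.restrictScalars R)) :
    IsUnitFrob (frobAction R p e N) := by
  constructor
  · intro s t hst
    refine Module.Flat.lTensor_preserves_injective_linearMap (M := FrobTwist R p e)
      (N.subtype.restrictScalars R) N.subtype_injective (hM.1 ?_)
    rw [structureMap_subtype, structureMap_subtype, hst]
  · rw [structureMap_surjective_iff, eq_top_iff]
    rintro ⟨m, hm⟩ -
    have key : ∀ x ∈ frobSpan (frobAction R p e M) (N.restrictScalars R),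
        x ∈ (frobSpan (frobAction R p e N) ⊤).map (N.subtype.restrictScalars R) := by
      refine (frobSpan_le _).mpr fun x hx => ?_
      exact ⟨frobAction R p e N ⟨x, hx⟩, mem_frobSpan_of_mem _ trivial, rfl⟩
    obtain ⟨y, hy, hym⟩ := key m (hN hm)
    rwa [show y = ⟨m, hm⟩ from Subtype.ext hym] at hy

theorem finite_submodule_of_frobSpan {B : Submodule R M} (hB : B.FG)
    (hBN : B ≤ N.restrictScalars R)
    (hN : ∀ m ∈ N, ∃ r, m ∈ frobSpan (frobIter (frobAction R p e M) r) B) :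
    Module.Finite (FrobRing R p e) N := by
  obtain ⟨T, rfl⟩ := hB
  refine Module.Finite.iff_fg.mpr ⟨T, le_antisymm
    (Submodule.span_le.mpr fun t ht => hBN (Submodule.subset_span ht)) fun m hm => ?_⟩
  obtain ⟨r, hr⟩ := hN m hm
  rw [frobSpan_span] at hr
  have : Submodule.span R (frobIter (frobAction R p e M) r '' T) ≤
      (Submodule.span (FrobRing R p e) (T : Set M)).restrictScalars R := by
    refine Submodule.span_le.mpr ?_
    rintro _ ⟨t, ht, rfl⟩
    clear hr
    induction r with
    | zero => exact Submodule.subset_span ht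
    | succ r ih =>
      rw [frobIter_succ]
      exact (Submodule.span (FrobRing R p e) (T : Set M)).smul_mem (frobVar R p e) ih
  exact this hr

end FrobRing

end FrobD

/-! ### The main theorem. -/

theorem proposition3 {R : Type*} [CommRing R] [IsRegularRing R]
    (p : ℕ) [Fact p.Prime] [CharP R p] (hF : (frobenius R p).Finite)
    (e : ℕ) (he : 0 < e)
    {M : Type*} [AddCommGroup M] [Module R M] [Module (FrobD.FrobRing R p e) M]
    [IsScalarTower R (FrobD.FrobRing R p e) M]
    (hM : FrobD.IsUnitFrob (FrobD.frobAction R p e M))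
    (hfg : Module.Finite (FrobD.FrobRing R p e) M)
    (N : Submodule (FrobD.FrobRing R p e) M)
    (hN : FrobD.IsDiffOpFrobSubmodule he hM N) :
    FrobD.IsUnitFrob (FrobD.frobAction R p e N) ∧
      Module.Finite (FrobD.FrobRing R p e) N := by
  have hproj : ∀ n, Module.Projective R (FrobD.FrobTwist R p n) := FrobD.projective_frobTwist R p hF
  have hfin : ∀ n, Module.Finite R (FrobD.FrobTwist R p n) :=
    FrobD.finite_iterateFrobenius R p hF
  let b : ∀ n, FrobD.FrobDualBasis R p n := fun n => (FrobD.nonempty_frobDualBasis n).some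
  obtain ⟨A, hA⟩ := FrobD.exists_isRoot hM.2
  have hNF : ∀ m ∈ N.restrictScalars R, FrobD.frobAction R p e M m ∈ N.restrictScalars R :=
    fun m hm => N.smul_mem _ hm
  have hdesc := fun r => FrobD.le_frobSpan_comap_of_diffOpAction_mem he hM
    (N := N.restrictScalars R) hN (b (e * r))
  constructor
  · refine FrobD.isUnitFrob_submodule N hM ?_
    -- Descent at level one gives N ⊆ R·F(N_1), and N_1 ⊆ N.
    have h1 := hdesc 1
    rw [FrobD.frobSpan_frobIter_succ, FrobD.frobSpan_frobIter_zero] at h1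
    exact h1.trans (FrobD.frobSpan_mono _ fun x hx =>
      FrobD.mem_of_apply_mem_of_isRoot b hM hNF hdesc hA hx)
  · refine FrobD.finite_submodule_of_frobSpan N (B := N.restrictScalars R ⊓ A)
      (hA.fg.of_le inf_le_right) inf_le_left fun m hm => ?_
    exact FrobD.exists_mem_frobSpan_inf_of_isRoot b hM hNF hdesc hA hm
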